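/- For integers $b\ge 2$ and $n\ge 1$ let $d_b(n)$ denote the sum of the base-$b$ digits of $n$, let $S_b(n)=\sum_{j=1}^{n-1}d_b(j)$, and put $$\overline{\nu}(n,b)=\frac{2}{b-1}S_b(n)-\frac{n-1}{b-1}d_b(n).$$ For real $x\ge 1$ let $$\overline{\overline{G}}(n,x)=\prod_{b=2}^{\lfloor x\rfloor} b^{\overline{\nu}(n,b)}.$$ Let $\gamma$ be Euler's constant, $H_m=\sum_{j=1}^m\frac1j$, and define $f(0)=g(0)=0$ and, for real $\alpha>0$, $$f(\alpha)=\frac12+\frac12\alpha^2\Big\lfloor\frac1\alpha\Big\rfloor^2+\frac12\alpha^2\Big\lfloor\frac1\alpha\Big\rfloor-\alpha\Big\lfloor\frac1\alpha\Big\rfloor,$$ $$g(\alpha)=\Big(\frac12\gamma-\frac34\Big)-\frac12\Big(H_{\lfloor 1/\alpha\rfloor}-\log\frac1\alpha\Big)+\Big(\log\frac1\alpha\Big)\Big(-\frac12-\frac12\alpha^2\Big\lfloor\frac1\alpha\Big\rfloor\Big\lfloor\frac1\alpha+1\Big\rfloor+\alpha\Big\lfloor\frac1\alpha\Big\rfloor\Big)-\frac14\alpha^2\Big\lfloor\frac1\alpha\Big\rfloor\Big\lfloor\frac1\alpha+1\Big\rfloor+\alpha\Big\lfloor\frac1\alpha\Big\rfloor.$$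 Then for all integers $n\ge 2$ and all real $\alpha\in\big[\frac1{\sqrt n},1\big]$, $$\log\overline{\overline{G}}(n,\alpha n)=f(\alpha)\,n^2\log n+g(\alpha)\,n^2+O\big(n^{3/2}\log n\big),$$ and for all integers $n\ge 2$ and all real $\alpha\in\big[\frac1n,\frac1{\sqrt n}\big]$, $$\log\overline{\overline{G}}(n,\alpha n)=O\big(n^{3/2}\log n\big).$$ Both implied constants are absolute (independent of $n$ and $\alpha$). -/

import Mathlib

noncomputable section

namespace GenBinomProd

/-- `d_b(n)`: the sum of the base-`b` digits of `n`. -/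
def digitSum (b n : ℕ) : ℕ := (Nat.digits b n).sum

/-- `S_b(n) = ∑_{j=1}^{n-1} d_b(j)`: the running digit sum. -/
def runningDigitSum (b n : ℕ) : ℕ := ∑ j ∈ Finset.Ico 1 n, digitSum b j

/-- `ν̄(n,b) = 2/(b-1) · S_b(n) - (n-1)/(b-1) · d_b(n)`, as a real number. -/
def radixExponent (n b : ℕ) : ℝ :=
  2 / ((b : ℝ) - 1) * (runningDigitSum b n : ℝ)
    - ((n : ℝ) - 1) / ((b : ℝ) - 1) * (digitSum b n : ℝ)

/-- The partial factorization `∏_{2 ≤ b ≤ x} b ^ ν̄(n,b)`, over integers `b`. -/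
def partialProduct (n : ℕ) (x : ℝ) : ℝ :=
  ∏ b ∈ Finset.Icc 2 ⌊x⌋₊, (b : ℝ) ^ radixExponent n b

/-- The limit function `f`, with `f(0) = 0`. -/
def limitF (α : ℝ) : ℝ :=
  if 0 < α then
    1 / 2 + 1 / 2 * α ^ 2 * (⌊1 / α⌋ : ℝ) ^ 2 + 1 / 2 * α ^ 2 * (⌊1 / α⌋ : ℝ)
      - α * (⌊1 / α⌋ : ℝ)
  else 0

/-- The limit function `g`, with `g(0) = 0`. -/
def limitG (α : ℝ) : ℝ :=
  if 0 < α then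
    (1 / 2 * Real.eulerMascheroniConstant - 3 / 4)
      - 1 / 2 * ((harmonic ⌊1 / α⌋₊ : ℝ) - Real.log (1 / α))
      + Real.log (1 / α) *
          (-(1 / 2) - 1 / 2 * α ^ 2 * (⌊1 / α⌋ : ℝ) * (⌊1 / α + 1⌋ : ℝ) + α * (⌊1 / α⌋ : ℝ))
      - 1 / 4 * α ^ 2 * (⌊1 / α⌋ : ℝ) * (⌊1 / α + 1⌋ : ℝ)
      + α * (⌊1 / α⌋ : ℝ)
  else 0

end GenBinomProd

end

/-! Let `K = ⌊√n⌋`. Bases `b ≤ K` matter only through the crude bound `4 n log n` per base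
(`abs_radixExponent_mul_log_le`), which already settles `α ≤ 1/√n`. For `b > K` all numbers up to
`n` have at most two digits, and with `q = ⌊n/b⌋` the exponent is exactly `b q (q+1) - q (n+1)`
(`radixExponent_of_lt_sq`). Up to the small term `-q`, this is `∑_{k ≤ q} (2kb - n)`. Exchanging
sums (`sum_floor_div_mul_log_eq`) leaves `K` smooth sums over `K < b ≤ min(αn, n/k)`, each equal to
its integral up to `3 n log n`. The cutoff is `αn` for `k ≤ 1/α`; for larger `k` it is `n/k`, where
the upper-endpoint term collapses to `n²/(2k)` and a harmonic difference appears. The lower-endpoint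
terms combine with `H_K` into the constants of `g`, up to `O(n K log n)` (`abs_boundary_term_le`).
-/

/-! ### Exponents for bases above `√n` -/

open Finset in
-- For `b ≥ 1`, `⌊j/b⌋` counts the `i ≥ 1` with `ib ≤ j`, so its sum over `j < n` is `∑_{i ≤ n/b} (n
-- - ib)`.
theorem sum_digits_closed (b n : ℕ) :
    ∑ j ∈ range n, ((j : ℝ) - ((b : ℝ) - 1) * ((j / b : ℕ) : ℝ)) =
      (n : ℝ) * (n - 1) / 2 - ((b : ℝ) - 1) *
        (((n / b : ℕ) : ℝ) * n - b * ((n / b : ℕ) : ℝ) * (((n / b : ℕ) : ℝ) + 1) / 2) := by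
  induction n with
  | zero => simp
  | succ n ih =>
    rw [sum_range_succ, ih, Nat.succ_div]
    split_ifs with h
    · have h1 : n + 1 = b * (n / b + 1) := by
        have h2 := Nat.div_mul_cancel h
        rw [Nat.succ_div, if_pos h] at h2
        rw [← h2, mul_comm]
      have h3 : (n : ℝ) + 1 = b * (((n / b : ℕ) : ℝ) + 1) := by exact_mod_cast h1
      have h4 : (n : ℝ) = b * (((n / b : ℕ) : ℝ) + 1) - 1 := by linarith
      push_cast
      generalize ((n / b : ℕ) : ℝ) = q at *
      rw [h4]
      ring
    · push_cast
      ring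

theorem digitSum_of_lt_sq (b j : ℕ) (hb : 2 ≤ b) (hj : j < b ^ 2) :
    (GenBinomProd.digitSum b j : ℝ) = (j : ℝ) - ((b : ℝ) - 1) * ((j / b : ℕ) : ℝ) := by
  have key : GenBinomProd.digitSum b j = j % b + j / b := by
    unfold GenBinomProd.digitSum
    rcases Nat.eq_zero_or_pos j with rfl | hpos
    · simp
    rw [Nat.digits_def' (by omega) hpos, List.sum_cons]
    have hlt : j / b < b := Nat.div_lt_of_lt_mul (by rwa [← sq])
    rcases Nat.eq_zero_or_pos (j / b) with h0 | h0
    · simp [h0]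
    · rw [Nat.digits_of_lt b _ h0.ne' hlt]
      simp
  have h : (j : ℝ) = b * ((j / b : ℕ) : ℝ) + ((j % b : ℕ) : ℝ) := by
    exact_mod_cast (Nat.div_add_mod j b).symm
  rw [key]
  push_cast
  linarith

/-- The two terms `n(n-1)/(b-1)` cancel, and what remains is divisible by `b - 1`. -/
theorem radixExponent_of_lt_sq (b n : ℕ) (hb : 2 ≤ b) (hn : 1 ≤ n) (hnb : n < b ^ 2) :
    GenBinomProd.radixExponent n b =
      (b : ℝ) * ((n / b : ℕ) : ℝ) * (((n / b : ℕ) : ℝ) + 1) - ((n / b : ℕ) : ℝ) * (n + 1) := by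
  have hS : (GenBinomProd.runningDigitSum b n : ℝ) =
      ∑ j ∈ Finset.range n, ((j : ℝ) - ((b : ℝ) - 1) * ((j / b : ℕ) : ℝ)) := by
    unfold GenBinomProd.runningDigitSum
    rw [Finset.range_eq_Ico, Finset.sum_eq_sum_Ico_succ_bot (by omega : 0 < n)]
    push_cast
    simp only [Nat.zero_div, Nat.cast_zero, mul_zero, sub_zero, zero_add]
    refine Finset.sum_congr rfl fun j hj => ?_
    exact digitSum_of_lt_sq b j hb ((Finset.mem_Ico.1 hj).2.trans hnb)
  have hb1 : (b : ℝ) - 1 ≠ 0 := by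
    have : (2 : ℝ) ≤ b := by exact_mod_cast hb
    linarith
  unfold GenBinomProd.radixExponent
  rw [hS, sum_digits_closed b n, digitSum_of_lt_sq b n hb hnb]
  field_simp
  ring

/-! ### Crude bounds for small bases -/

/-- There are `Nat.log b j + 1` digits, each at most `b - 1`; that factor later cancels the
denominator of the exponent. -/
theorem digitSum_mul_log_le (b n j : ℕ) (hb : 2 ≤ b) (hbn : b ≤ n) (hj : j ≤ n) :
    (GenBinomProd.digitSum b j : ℝ) * Real.log b ≤ ((b : ℝ) - 1) * (2 * Real.log n) := by
  have hb2 : (2 : ℝ) ≤ b := by exact_mod_cast hb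
  have hlogb : 0 ≤ Real.log b := Real.log_nonneg (by linarith)
  have hlogbn : Real.log b ≤ Real.log n :=
    Real.log_le_log (by linarith) (by exact_mod_cast hbn)
  rcases Nat.eq_zero_or_pos j with rfl | hpos
  · simp only [GenBinomProd.digitSum, Nat.digits_zero, List.sum_nil, Nat.cast_zero, zero_mul]
    exact mul_nonneg (by linarith) (by linarith)
  have hlen : GenBinomProd.digitSum b j ≤ (Nat.log b j + 1) * (b - 1) := by
    have h := List.sum_le_card_nsmul (Nat.digits b j) (b - 1) fun d hd =>
      Nat.le_sub_one_of_lt (Nat.digits_lt_base (by omega) hd)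
    rwa [Nat.length_digits b j (by omega) hpos.ne', smul_eq_mul] at h
  have hlen' : (GenBinomProd.digitSum b j : ℝ) ≤ ((Nat.log b j : ℝ) + 1) * ((b : ℝ) - 1) := by
    have : ((b - 1 : ℕ) : ℝ) = (b : ℝ) - 1 := by
      rw [Nat.cast_sub (by omega), Nat.cast_one]
    rw [← this]
    exact_mod_cast hlen
  have hpow : (Nat.log b j : ℝ) * Real.log b ≤ Real.log n := by
    rw [← Real.log_pow]
    refine Real.log_le_log (by positivity) ?_
    exact_mod_cast (Nat.pow_log_le_self b hpos.ne').trans hj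
  calc (GenBinomProd.digitSum b j : ℝ) * Real.log b
      ≤ ((Nat.log b j : ℝ) + 1) * ((b : ℝ) - 1) * Real.log b :=
        mul_le_mul_of_nonneg_right hlen' hlogb
    _ = ((b : ℝ) - 1) * ((Nat.log b j : ℝ) * Real.log b + Real.log b) := by ring
    _ ≤ ((b : ℝ) - 1) * (2 * Real.log n) :=
        mul_le_mul_of_nonneg_left (by linarith) (by linarith)

theorem abs_radixExponent_mul_log_le (b n : ℕ) (hb : 2 ≤ b) (hbn : b ≤ n) :
    |GenBinomProd.radixExponent n b * Real.log b| ≤ 4 * n * Real.log n := by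
  have hb2 : (2 : ℝ) ≤ b := by exact_mod_cast hb
  have hn2 : (2 : ℝ) ≤ n := by exact_mod_cast hb.trans hbn
  have hb1 : (0 : ℝ) < (b : ℝ) - 1 := by linarith
  have hlogb : 0 ≤ Real.log b := Real.log_nonneg (by linarith)
  have hlogn : 0 ≤ Real.log n := Real.log_nonneg (by linarith)
  have hS : (GenBinomProd.runningDigitSum b n : ℝ) * Real.log b ≤
      n * (((b : ℝ) - 1) * (2 * Real.log n)) := by
    unfold GenBinomProd.runningDigitSum
    push_cast
    rw [Finset.sum_mul]
    refine (Finset.sum_le_card_nsmul _ _ (((b : ℝ) - 1) * (2 * Real.log n)) fun j hj =>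
      digitSum_mul_log_le b n j hb hbn (Finset.mem_Ico.1 hj).2.le).trans ?_
    rw [nsmul_eq_mul]
    refine mul_le_mul_of_nonneg_right ?_ (by positivity)
    rw [Nat.card_Ico]
    exact_mod_cast Nat.sub_le n 1
  have hd := digitSum_mul_log_le b n n hb hbn le_rfl
  have h1 : GenBinomProd.radixExponent n b * Real.log b =
      2 * ((GenBinomProd.runningDigitSum b n : ℝ) * Real.log b / ((b : ℝ) - 1)) -
        ((n : ℝ) - 1) * ((GenBinomProd.digitSum b n : ℝ) * Real.log b / ((b : ℝ) - 1)) := by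
    unfold GenBinomProd.radixExponent
    ring
  have hS' : (GenBinomProd.runningDigitSum b n : ℝ) * Real.log b / ((b : ℝ) - 1) ≤
      n * (2 * Real.log n) := by
    rw [div_le_iff₀ hb1]
    linarith
  have hd' : (GenBinomProd.digitSum b n : ℝ) * Real.log b / ((b : ℝ) - 1) ≤
      2 * Real.log n := by
    rw [div_le_iff₀ hb1]
    linarith
  have hS0 : 0 ≤ (GenBinomProd.runningDigitSum b n : ℝ) * Real.log b / ((b : ℝ) - 1) := by
    positivity
  have hd0 : 0 ≤ (GenBinomProd.digitSum b n : ℝ) * Real.log b / ((b : ℝ) - 1) := by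
    positivity
  rw [h1, abs_le]
  have h2 := mul_le_mul_of_nonneg_left hd' (by linarith : (0 : ℝ) ≤ (n : ℝ) - 1)
  have h3 := mul_nonneg (by linarith : (0 : ℝ) ≤ (n : ℝ) - 1) hd0
  have h4 : 0 ≤ (n : ℝ) * Real.log n := by positivity
  constructor <;> linarith

theorem log_partialProduct (n : ℕ) (x : ℝ) :
    Real.log (GenBinomProd.partialProduct n x) =
      ∑ b ∈ Finset.Ioc 1 ⌊x⌋₊, GenBinomProd.radixExponent n b * Real.log b := by
  have hpos : ∀ b ∈ Finset.Icc 2 ⌊x⌋₊, (0 : ℝ) < b := fun b hb => by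
    have := (Finset.mem_Icc.1 hb).1
    exact_mod_cast (by omega : 0 < b)
  unfold GenBinomProd.partialProduct
  rw [Real.log_prod fun b hb => (Real.rpow_pos_of_pos (hpos b hb) _).ne']
  exact Finset.sum_congr rfl fun b hb => Real.log_rpow (hpos b hb) _

theorem abs_sum_radixExponent_mul_log_le (n N : ℕ) (hN : N ≤ n) (hn : 2 ≤ n) :
    |∑ b ∈ Finset.Ioc 1 N, GenBinomProd.radixExponent n b * Real.log b| ≤
      N * (4 * n * Real.log n) := by
  have hlogn : 0 ≤ Real.log n := Real.log_natCast_nonneg n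
  refine (Finset.abs_sum_le_sum_abs _ _).trans ?_
  refine (Finset.sum_le_card_nsmul _ _ (4 * n * Real.log n) fun b hb => ?_).trans ?_
  · obtain ⟨h1, h2⟩ := Finset.mem_Ioc.1 hb
    exact abs_radixExponent_mul_log_le b n h1 (h2.trans hN)
  · rw [nsmul_eq_mul, Nat.card_Ioc]
    refine mul_le_mul_of_nonneg_right ?_ (by positivity)
    exact_mod_cast Nat.sub_le N 1

/-! ### Sums against integrals -/

/-- Comparison of a sum of a nonnegative monotone function with its primitive. -/
theorem abs_sum_sub_primitive_le (h H : ℝ → ℝ) (K : ℕ) (y : ℝ) (hy : (K : ℝ) ≤ y)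
    (hmono : MonotoneOn h (Set.Ici (K : ℝ))) (h0 : 0 ≤ h K)
    (hH : ∀ t : ℝ, (K : ℝ) ≤ t → HasDerivAt H (h t) t) :
    |∑ b ∈ Finset.Ioc K ⌊y⌋₊, h b - (H y - H K)| ≤ h y := by
  -- Mean value theorem; used on unit intervals and on the last partial interval `[⌊y⌋, y]`.
  have incr : ∀ u v : ℝ, (K : ℝ) ≤ u → u ≤ v →
      h u * (v - u) ≤ H v - H u ∧ H v - H u ≤ h v * (v - u) := by
    intro u v hu huv
    rcases huv.eq_or_lt with rfl | hlt
    · simp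
    obtain ⟨c, ⟨hc1, hc2⟩, hc⟩ := exists_hasDerivAt_eq_slope H h hlt
      (fun t ht => (hH t (hu.trans ht.1)).continuousAt.continuousWithinAt)
      (fun t ht => hH t (hu.trans ht.1.le))
    have hvu : 0 < v - u := sub_pos.2 hlt
    rw [eq_div_iff hvu.ne'] at hc
    rw [← hc]
    exact ⟨mul_le_mul_of_nonneg_right (hmono hu (hu.trans hc1.le) hc1.le) hvu.le,
      mul_le_mul_of_nonneg_right (hmono (hu.trans hc1.le) (hu.trans huv) hc2.le) hvu.le⟩
  have nat : ∀ N : ℕ, K ≤ N → H N - H K ≤ ∑ b ∈ Finset.Ioc K N, h b ∧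
      ∑ b ∈ Finset.Ioc K N, h b ≤ H N - H K + h N := by
    intro N hN
    induction N, hN using Nat.le_induction with
    | base => simpa using h0
    | succ N hN ih =>
      rw [Finset.sum_Ioc_succ_top hN]
      have h1 := incr N (N + 1) (by exact_mod_cast hN) (by linarith)
      simp only [add_sub_cancel_left, mul_one] at h1
      push_cast
      constructor <;> linarith [h1.1, h1.2, ih.1, ih.2]
  have hy0 : 0 ≤ y := (Nat.cast_nonneg K).trans hy
  have hKN : K ≤ ⌊y⌋₊ := Nat.le_floor hy
  have hKN' : (K : ℝ) ≤ (⌊y⌋₊ : ℝ) := by exact_mod_cast hKN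
  have hNy := Nat.floor_le hy0
  have hyN := Nat.lt_floor_add_one y
  obtain ⟨h1, h2⟩ := nat ⌊y⌋₊ hKN
  obtain ⟨h3, h4⟩ := incr ⌊y⌋₊ y hKN' hNy
  have hN0 : 0 ≤ h ⌊y⌋₊ := h0.trans (hmono (Set.mem_Ici.2 le_rfl) hKN' hKN')
  have hNh : h ⌊y⌋₊ ≤ h y := hmono hKN' hy hNy
  have h5 : 0 ≤ h ⌊y⌋₊ * (y - ⌊y⌋₊) := mul_nonneg hN0 (by linarith)
  have h6 : h y * (y - ⌊y⌋₊) ≤ h y * 1 :=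
    mul_le_mul_of_nonneg_left (by linarith) (hN0.trans hNh)
  rw [abs_le]
  constructor <;> linarith

theorem abs_sum_log_sub_le (K : ℕ) (hK : 1 ≤ K) (y : ℝ) (hy : (K : ℝ) ≤ y) :
    |∑ b ∈ Finset.Ioc K ⌊y⌋₊, Real.log b -
      ((y * Real.log y - y) - (K * Real.log K - K))| ≤ Real.log y := by
  have hK1 : (1 : ℝ) ≤ K := by exact_mod_cast hK
  refine abs_sum_sub_primitive_le Real.log (fun t => t * Real.log t - t) K y hy ?_
    (Real.log_nonneg hK1) ?_
  · intro u hu v _ huv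
    exact Real.log_le_log (by linarith [Set.mem_Ici.1 hu]) huv
  · intro t ht
    have := (Real.hasDerivAt_mul_log (by linarith : t ≠ 0)).sub (hasDerivAt_id t)
    exact this.congr_deriv (by ring)

theorem abs_sum_mul_log_sub_le (K : ℕ) (hK : 1 ≤ K) (y : ℝ) (hy : (K : ℝ) ≤ y) :
    |∑ b ∈ Finset.Ioc K ⌊y⌋₊, (b : ℝ) * Real.log b -
      ((y ^ 2 / 2 * Real.log y - y ^ 2 / 4) - ((K : ℝ) ^ 2 / 2 * Real.log K - (K : ℝ) ^ 2 / 4))|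
      ≤ y * Real.log y := by
  have hK1 : (1 : ℝ) ≤ K := by exact_mod_cast hK
  refine abs_sum_sub_primitive_le (fun t => t * Real.log t)
    (fun t => t ^ 2 / 2 * Real.log t - t ^ 2 / 4) K y hy ?_
    (mul_nonneg (by linarith) (Real.log_nonneg hK1)) ?_
  · intro u hu v _ huv
    have hu1 : (1 : ℝ) ≤ u := hK1.trans hu
    exact mul_le_mul huv (Real.log_le_log (by linarith) huv) (Real.log_nonneg hu1) (by linarith)
  · intro t ht
    have ht0 : t ≠ 0 := by linarith
    have h1 := (((hasDerivAt_pow 2 t).div_const 2).mul (Real.hasDerivAt_log ht0)).sub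
      ((hasDerivAt_pow 2 t).div_const 4)
    refine h1.congr_deriv ?_
    field_simp
    ring

/-- Since `k y ≤ n`, the factor `2k` costs only `2 n log n`, so the error is uniform in `k`. -/
theorem abs_sum_linear_mul_log_sub_le (n K k : ℕ) (hK : 1 ≤ K) (hk : 1 ≤ k) (y : ℝ)
    (hy : (K : ℝ) ≤ y) (hyn : y ≤ (n : ℝ) / k) :
    |∑ b ∈ Finset.Ioc K ⌊y⌋₊, (2 * (k : ℝ) * b - n) * Real.log b -
      (2 * (k : ℝ) * ((y ^ 2 / 2 * Real.log y - y ^ 2 / 4) -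
          ((K : ℝ) ^ 2 / 2 * Real.log K - (K : ℝ) ^ 2 / 4)) -
        n * ((y * Real.log y - y) - (K * Real.log K - K)))| ≤ 3 * n * Real.log n := by
  have hK1 : (1 : ℝ) ≤ K := by exact_mod_cast hK
  have hk1 : (1 : ℝ) ≤ k := by exact_mod_cast hk
  have hlogy : 0 ≤ Real.log y := Real.log_nonneg (hK1.trans hy)
  have hky : (k : ℝ) * y ≤ n := by
    rw [le_div_iff₀ (by linarith)] at hyn
    linarith
  have hyn' : y ≤ n := by nlinarith
  have hlog : Real.log y ≤ Real.log n := Real.log_le_log (by linarith) hyn'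
  have hA := abs_sum_mul_log_sub_le K hK y hy
  have hB := abs_sum_log_sub_le K hK y hy
  have hsum : ∑ b ∈ Finset.Ioc K ⌊y⌋₊, (2 * (k : ℝ) * b - n) * Real.log b =
      2 * k * ∑ b ∈ Finset.Ioc K ⌊y⌋₊, (b : ℝ) * Real.log b -
        n * ∑ b ∈ Finset.Ioc K ⌊y⌋₊, Real.log b := by
    rw [Finset.mul_sum, Finset.mul_sum, ← Finset.sum_sub_distrib]
    exact Finset.sum_congr rfl fun b _ => by ring
  rw [hsum]
  generalize ∑ b ∈ Finset.Ioc K ⌊y⌋₊, (b : ℝ) * Real.log b = A at *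
  generalize ∑ b ∈ Finset.Ioc K ⌊y⌋₊, Real.log b = B at *
  have hA' := mul_le_mul_of_nonneg_left hA (by linarith : (0 : ℝ) ≤ 2 * k)
  have hB' := mul_le_mul_of_nonneg_left hB (Nat.cast_nonneg (α := ℝ) n)
  have h1 : 2 * (k : ℝ) * (y * Real.log y) ≤ 2 * (n * Real.log n) := by
    have : (k : ℝ) * y * Real.log y ≤ n * Real.log n := mul_le_mul hky hlog hlogy (by positivity)
    linarith
  have h2 : (n : ℝ) * Real.log y ≤ n * Real.log n :=
    mul_le_mul_of_nonneg_left hlog (by positivity)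
  rw [← abs_of_nonneg (by linarith : (0 : ℝ) ≤ 2 * k), ← abs_mul,
    abs_of_nonneg (by linarith : (0 : ℝ) ≤ 2 * k)] at hA'
  rw [← abs_of_nonneg (Nat.cast_nonneg (α := ℝ) n), ← abs_mul,
    abs_of_nonneg (Nat.cast_nonneg (α := ℝ) n)] at hB'
  rw [abs_le] at *
  constructor <;> linarith [hA'.1, hA'.2, hB'.1, hB'.2]

/-! ### Exchange of summation -/

theorem sum_Ioc_cast (q : ℕ) : ∑ k ∈ Finset.Ioc 0 q, (k : ℝ) = (q : ℝ) * (q + 1) / 2 := by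
  induction q with
  | zero => simp
  | succ q ih =>
    rw [Finset.sum_Ioc_succ_top (Nat.zero_le q), ih]
    push_cast
    ring

theorem sum_Ioc_linear (q : ℕ) (b n : ℝ) :
    ∑ k ∈ Finset.Ioc 0 q, (2 * (k : ℝ) * b - n) = b * q * (q + 1) - q * n := by
  rw [Finset.sum_sub_distrib, ← Finset.sum_mul, ← Finset.mul_sum, sum_Ioc_cast]
  simp
  ring

theorem sum_floor_div_mul_log_eq (n K X : ℕ) (hK : n < (K + 1) ^ 2) :
    ∑ b ∈ Finset.Ioc K X, ((b : ℝ) * ((n / b : ℕ) : ℝ) * (((n / b : ℕ) : ℝ) + 1) -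
        ((n / b : ℕ) : ℝ) * n) * Real.log b =
      ∑ k ∈ Finset.Ioc 0 K, ∑ b ∈ Finset.Ioc K (min X (n / k)),
        (2 * (k : ℝ) * b - n) * Real.log b := by
  have h1 : ∀ b ∈ Finset.Ioc K X, ((b : ℝ) * ((n / b : ℕ) : ℝ) * (((n / b : ℕ) : ℝ) + 1) -
      ((n / b : ℕ) : ℝ) * n) * Real.log b =
      ∑ k ∈ Finset.Ioc 0 (n / b), (2 * (k : ℝ) * b - n) * Real.log b := fun b _ => by
    rw [← Finset.sum_mul, sum_Ioc_linear]
  rw [Finset.sum_congr rfl h1]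
  refine Finset.sum_comm' fun b k => ?_
  simp only [Finset.mem_Ioc, le_min_iff]
  constructor
  · rintro ⟨⟨hb1, hb2⟩, hk1, hk2⟩
    have hkb : k * b ≤ n := (Nat.le_div_iff_mul_le (by omega)).1 hk2
    refine ⟨⟨hb1, hb2, (Nat.le_div_iff_mul_le hk1).2 (by linarith)⟩, hk1, ?_⟩
    -- If `k` and `b` were both at least `K + 1`, then `k b ≥ (K+1)² > n`.
    by_contra! hlt
    nlinarith
  · rintro ⟨⟨hb1, hb2, hb3⟩, hk1, _⟩
    have hkb : b * k ≤ n := (Nat.le_div_iff_mul_le hk1).1 hb3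
    exact ⟨⟨hb1, hb2⟩, hk1, (Nat.le_div_iff_mul_le (by omega)).2 (by linarith)⟩

/-! ### Harmonic numbers and the boundary at `√n` -/

theorem sum_Ioc_one_div_eq_harmonic (K : ℕ) :
    ∑ k ∈ Finset.Ioc 0 K, 1 / (k : ℝ) = (harmonic K : ℝ) := by
  induction K with
  | zero => simp
  | succ K ih =>
    rw [Finset.sum_Ioc_succ_top (Nat.zero_le K), ih, harmonic_succ]
    push_cast
    ring

theorem harmonic_sub_log_sub_eulerMascheroni_mem (K : ℕ) (hK : 1 ≤ K) :
    0 ≤ (harmonic K : ℝ) - Real.log K - Real.eulerMascheroniConstant ∧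
      (harmonic K : ℝ) - Real.log K - Real.eulerMascheroniConstant ≤ 1 / K := by
  have h1 := Real.eulerMascheroniSeq_lt_eulerMascheroniConstant K
  have h2 := Real.eulerMascheroniConstant_lt_eulerMascheroniSeq' K
  have hK0 : (0 : ℝ) < K := by exact_mod_cast hK
  rw [Real.eulerMascheroniSeq'] at h2
  rw [if_neg (by omega)] at h2
  rw [Real.eulerMascheroniSeq] at h1
  have h3 : Real.log (K + 1) - Real.log K ≤ 1 / K := by
    rw [← Real.log_div (by positivity) hK0.ne']
    refine (Real.log_le_sub_one_of_pos (by positivity)).trans (le_of_eq ?_)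
    field_simp
    ring
  constructor <;> linarith

/-- The contribution of the lower summation limit `K = ⌊√n⌋` against the constant terms of the
limit functions. -/
theorem abs_boundary_term_le (n : ℕ) (hn : 2 ≤ n) (K : ℕ) (hK : 1 ≤ K) (hKn : K ^ 2 ≤ n)
    (hnK : n ≤ K ^ 2 + 2 * K) :
    |1 / 2 * (n : ℝ) ^ 2 * ((harmonic K : ℝ) - Real.eulerMascheroniConstant - Real.log n) +
      3 / 4 * (n : ℝ) ^ 2 -
      K * (K + 1) * ((K : ℝ) ^ 2 / 2 * Real.log K - (K : ℝ) ^ 2 / 4) +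
      n * K * (K * Real.log K - K)| ≤ 40 * (n * K * Real.log n) := by
  obtain ⟨s, rfl⟩ := Nat.exists_eq_add_of_le hKn
  have hs : s ≤ 2 * K := by omega
  have hK1 : (1 : ℝ) ≤ K := by exact_mod_cast hK
  have hs' : (s : ℝ) ≤ 2 * K := by exact_mod_cast hs
  have hs0 : (0 : ℝ) ≤ s := Nat.cast_nonneg s
  obtain ⟨hH1, hH2⟩ := harmonic_sub_log_sub_eulerMascheroni_mem K hK
  have hlog2 : (1 : ℝ) / 2 ≤ Real.log ((K ^ 2 + s : ℕ) : ℝ) := by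
    have h2 : Real.log 2 ≤ Real.log ((K ^ 2 + s : ℕ) : ℝ) :=
      Real.log_le_log (by norm_num) (by exact_mod_cast hn)
    linarith [Real.log_two_gt_d9]
  have hn0 : (0 : ℝ) < (K : ℝ) ^ 2 + s := by positivity
  have hcast : ((K ^ 2 + s : ℕ) : ℝ) = (K : ℝ) ^ 2 + s := by push_cast; rfl
  rw [hcast] at hlog2 ⊢
  have hlogK : 0 ≤ Real.log K := Real.log_nonneg hK1
  have hl1 : 0 ≤ Real.log ((K : ℝ) ^ 2 + s) - 2 * Real.log K := by
    have := Real.log_le_log (by positivity) (by linarith : (K : ℝ) ^ 2 ≤ (K : ℝ) ^ 2 + s)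
    rw [Real.log_pow] at this
    push_cast at this
    linarith
  have hl2 : Real.log ((K : ℝ) ^ 2 + s) - 2 * Real.log K ≤ 2 / K := by
    have h2 : 2 * Real.log K = Real.log ((K : ℝ) ^ 2) := by
      rw [Real.log_pow]
      norm_num
    rw [h2, ← Real.log_div (by positivity) (by positivity)]
    refine (Real.log_le_sub_one_of_pos (by positivity)).trans ?_
    have : ((K : ℝ) ^ 2 + s) / (K : ℝ) ^ 2 - 1 = s / (K : ℝ) ^ 2 := by
      field_simp
      ring
    rw [this, div_le_div_iff₀ (by positivity) (by positivity)]
    nlinarith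
  generalize hL : Real.log (K : ℝ) = L at *
  generalize hM : Real.log ((K : ℝ) ^ 2 + s) = M at *
  generalize hE : (harmonic K : ℝ) = E at *
  generalize hc : Real.eulerMascheroniConstant = c at *
  generalize (K : ℝ) = k at *
  generalize (s : ℝ) = s at *
  have hk0 : 0 < k := by linarith
  have hn3 : k ^ 2 + s ≤ 3 * k ^ 2 := by nlinarith
  have hinv : (k ^ 2 + s) ^ 2 * (1 / k) ≤ 3 * ((k ^ 2 + s) * k) := by
    rw [mul_one_div, div_le_iff₀ hk0]
    nlinarith [mul_le_mul_of_nonneg_left hn3 hn0.le]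
  have hu1 : (k ^ 2 + s) ^ 2 * (E - L - c) ≤ 3 * ((k ^ 2 + s) * k) :=
    (mul_le_mul_of_nonneg_left hH2 (by positivity)).trans hinv
  have hu0 : 0 ≤ (k ^ 2 + s) ^ 2 * (E - L - c) := mul_nonneg (by positivity) hH1
  have hv1 : (k ^ 2 + s) ^ 2 * (M - 2 * L) ≤ 6 * ((k ^ 2 + s) * k) := by
    have := mul_le_mul_of_nonneg_left hl2 (by positivity : 0 ≤ (k ^ 2 + s) ^ 2)
    have h2 : (k ^ 2 + s) ^ 2 * (2 / k) = 2 * ((k ^ 2 + s) ^ 2 * (1 / k)) := by ring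
    linarith
  have hv0 : 0 ≤ (k ^ 2 + s) ^ 2 * (M - 2 * L) := mul_nonneg (by positivity) hl1
  have hk3 : k ^ 3 ≤ (k ^ 2 + s) * k := by nlinarith
  have hs2 : s ^ 2 ≤ 4 * ((k ^ 2 + s) * k) := by nlinarith
  have hsk : s * k ^ 2 ≤ 2 * ((k ^ 2 + s) * k) := by nlinarith
  have hP : 0 < (k ^ 2 + s) * k := by positivity
  have hPM : (k ^ 2 + s) * k ≤ 2 * ((k ^ 2 + s) * k * M) := by nlinarith
  have hLM : L ≤ M := by linarith
  have hLP : (1 / 2 * s ^ 2 + 1 / 2 * k ^ 3) * L ≤ 5 / 2 * ((k ^ 2 + s) * k * M) := by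
    have := mul_le_mul (by linarith : 1 / 2 * s ^ 2 + 1 / 2 * k ^ 3 ≤ 5 / 2 * ((k ^ 2 + s) * k))
      hLM hlogK (by positivity)
    linarith
  have hLP0 : 0 ≤ (1 / 2 * s ^ 2 + 1 / 2 * k ^ 3) * L := by positivity
  -- With `n = k² + s`, the order `n²` parts cancel: the coefficient of `log K` completes the square
  -- `(n - k²)² = s²`, and `s ≤ 2k` makes every remaining term `O(n k log n)`.
  have hident : 1 / 2 * (k ^ 2 + s) ^ 2 * (E - c - M) + 3 / 4 * (k ^ 2 + s) ^ 2 -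
      k * (k + 1) * (k ^ 2 / 2 * L - k ^ 2 / 4) + (k ^ 2 + s) * k * (k * L - k) =
      1 / 2 * ((k ^ 2 + s) ^ 2 * (E - L - c)) - 1 / 2 * ((k ^ 2 + s) ^ 2 * (M - 2 * L)) -
        (1 / 2 * s ^ 2 + 1 / 2 * k ^ 3) * L + (3 / 4 * s ^ 2 + 1 / 2 * (s * k ^ 2) +
        1 / 4 * k ^ 3) := by
    ring
  have hs20 : 0 ≤ s ^ 2 := sq_nonneg s
  have hsk0 : 0 ≤ s * k ^ 2 := by positivity
  have hk30 : 0 ≤ k ^ 3 := by positivity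
  rw [hident, abs_le]
  constructor <;> linarith

/-! ### Main terms and assembly -/

/-- The sum of the main terms of the inner sums, in closed form. -/
theorem sum_main_terms_eq (n K q : ℕ) (hn : 1 ≤ n) (α : ℝ) (hα : 0 < α) (hq : q ≤ K)
    (hqα : ∀ k : ℕ, 1 ≤ k → (k ≤ q ↔ (k : ℝ) ≤ 1 / α)) (a β : ℝ → ℝ)
    (ha : ∀ y, a y = y ^ 2 / 2 * Real.log y - y ^ 2 / 4)
    (hβ : ∀ y, β y = y * Real.log y - y) :
    ∑ k ∈ Finset.Ioc 0 K, (2 * (k : ℝ) * (a (min (α * n) (n / k)) - a K) -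
        n * (β (min (α * n) (n / k)) - β K)) =
      q * (q + 1) * a (α * n) - n * q * β (α * n) +
        1 / 2 * (n : ℝ) ^ 2 * ((harmonic K : ℝ) - harmonic q) -
        K * (K + 1) * a K + n * K * β K := by
  have hn0 : (0 : ℝ) < n := by exact_mod_cast hn
  have hsplit : ∑ k ∈ Finset.Ioc 0 K, (2 * (k : ℝ) * (a (min (α * n) (n / k)) - a K) -
      n * (β (min (α * n) (n / k)) - β K)) =
      ∑ k ∈ Finset.Ioc 0 K, (2 * (k : ℝ) * a (min (α * n) (n / k)) -
        n * β (min (α * n) (n / k))) - ∑ k ∈ Finset.Ioc 0 K, (2 * (k : ℝ) * a K - n * β K) := by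
    rw [← Finset.sum_sub_distrib]
    exact Finset.sum_congr rfl fun k _ => by ring
  have hlow : ∑ k ∈ Finset.Ioc 0 q, (2 * (k : ℝ) * a (min (α * n) (n / k)) -
      n * β (min (α * n) (n / k))) =
      ∑ k ∈ Finset.Ioc 0 q, (2 * (k : ℝ) * a (α * n) - n * β (α * n)) := by
    refine Finset.sum_congr rfl fun k hk => ?_
    obtain ⟨hk1, hk2⟩ := Finset.mem_Ioc.1 hk
    have hk0 : (0 : ℝ) < k := by exact_mod_cast hk1
    have h := (hqα k hk1).1 hk2
    rw [le_div_iff₀ hα] at h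
    rw [min_eq_left]
    rw [le_div_iff₀ hk0]
    nlinarith
  have hhigh : ∑ k ∈ Finset.Ioc q K, (2 * (k : ℝ) * a (min (α * n) (n / k)) -
      n * β (min (α * n) (n / k))) = ∑ k ∈ Finset.Ioc q K, 1 / 2 * (n : ℝ) ^ 2 * (1 / k) := by
    refine Finset.sum_congr rfl fun k hk => ?_
    obtain ⟨hk1, hk2⟩ := Finset.mem_Ioc.1 hk
    have hk0 : (0 : ℝ) < k := by exact_mod_cast (by omega : 0 < k)
    have h := (hqα k (by omega)).not.1 (by omega)
    rw [not_le, div_lt_iff₀ hα] at h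
    rw [min_eq_right, ha, hβ]
    · field_simp
      ring
    · rw [div_le_iff₀ hk0]
      nlinarith
  rw [hsplit, ← Finset.sum_Ioc_consecutive _ (Nat.zero_le q) hq, hlow, hhigh, sum_Ioc_linear,
    sum_Ioc_linear, ← Finset.mul_sum, ← sum_Ioc_one_div_eq_harmonic K,
    ← sum_Ioc_one_div_eq_harmonic q,
    ← Finset.sum_Ioc_consecutive (fun k : ℕ => 1 / (k : ℝ)) (Nat.zero_le q) hq]
  ring

theorem limit_terms_eq (n : ℕ) (hn : 1 ≤ n) (α : ℝ) (hα : 0 < α) :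
    GenBinomProd.limitF α * (n : ℝ) ^ 2 * Real.log n + GenBinomProd.limitG α * (n : ℝ) ^ 2 =
      ⌊1 / α⌋₊ * (⌊1 / α⌋₊ + 1) *
          ((α * n) ^ 2 / 2 * Real.log (α * n) - (α * n) ^ 2 / 4) -
        n * ⌊1 / α⌋₊ * (α * n * Real.log (α * n) - α * n) -
        1 / 2 * (n : ℝ) ^ 2 * ((harmonic ⌊1 / α⌋₊ : ℝ) - Real.eulerMascheroniConstant -
          Real.log n) - 3 / 4 * (n : ℝ) ^ 2 := by
  have hn0 : (0 : ℝ) < n := by exact_mod_cast hn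
  have hfl : ((⌊1 / α⌋ : ℤ) : ℝ) = (⌊1 / α⌋₊ : ℝ) :=
    (natCast_floor_eq_intCast_floor (by positivity)).symm
  have hlog : Real.log (1 / α) = -Real.log α := by
    rw [one_div, Real.log_inv]
  unfold GenBinomProd.limitF GenBinomProd.limitG
  rw [if_pos hα, if_pos hα, Int.floor_add_one, Int.cast_add, Int.cast_one, hfl,
    Real.log_mul hα.ne' hn0.ne', hlog]
  ring

theorem abs_sum_radixExponent_sub_limit_le (n : ℕ) (hn : 2 ≤ n) (α : ℝ)
    (hα : 1 / Real.sqrt n ≤ α) (hα1 : α ≤ 1) :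
    |Real.log (GenBinomProd.partialProduct n (α * n)) -
      (GenBinomProd.limitF α * (n : ℝ) ^ 2 * Real.log n +
        GenBinomProd.limitG α * (n : ℝ) ^ 2)| ≤ 48 * (n * Nat.sqrt n * Real.log n) := by
  have hn0 : (0 : ℝ) < n := by exact_mod_cast (by omega : 0 < n)
  have hsq0 : 0 < Real.sqrt n := Real.sqrt_pos.2 hn0
  have hα0 : 0 < α := lt_of_lt_of_le (by positivity) hα
  have hlogn : 0 ≤ Real.log n := Real.log_natCast_nonneg n
  set K := Nat.sqrt n with hKdef
  have hK1 : 1 ≤ K := Nat.sqrt_pos.2 (by omega)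
  have hKn : K ^ 2 ≤ n := Nat.sqrt_le' n
  have hnK : n < (K + 1) ^ 2 := Nat.lt_succ_sqrt' n
  have hKle : K ≤ n := Nat.sqrt_le_self n
  have hKs : (K : ℝ) ≤ Real.sqrt n := Real.nat_sqrt_le_real_sqrt
  have hinv : 1 / α ≤ Real.sqrt n := by
    rw [div_le_iff₀ hsq0] at hα
    rw [div_le_iff₀ hα0]
    linarith
  have hsx : Real.sqrt n ≤ α * n := by
    rw [div_le_iff₀ hsq0] at hα
    nlinarith [Real.mul_self_sqrt hn0.le]
  set q := ⌊1 / α⌋₊ with hqdef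
  have hqK : q ≤ K := by
    rw [hKdef, ← Real.nat_floor_real_sqrt_eq_nat_sqrt]
    exact Nat.floor_mono hinv
  set X := ⌊α * n⌋₊ with hXdef
  have hKX : K ≤ X := Nat.le_floor (hKs.trans hsx)
  have hXn : X ≤ n := by
    rw [← Nat.floor_natCast (R := ℝ) n]
    exact Nat.floor_mono (by nlinarith)
  have hsmall := abs_sum_radixExponent_mul_log_le n K hKle hn
  have hlarge : ∑ b ∈ Finset.Ioc K X, GenBinomProd.radixExponent n b * Real.log b =
      ∑ k ∈ Finset.Ioc 0 K, ∑ b ∈ Finset.Ioc K (min X (n / k)),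
        (2 * (k : ℝ) * b - n) * Real.log b -
      ∑ b ∈ Finset.Ioc K X, ((n / b : ℕ) : ℝ) * Real.log b := by
    rw [← sum_floor_div_mul_log_eq n K X hnK, ← Finset.sum_sub_distrib]
    refine Finset.sum_congr rfl fun b hb => ?_
    obtain ⟨hb1, -⟩ := Finset.mem_Ioc.1 hb
    rw [radixExponent_of_lt_sq b n (by omega) (by omega)
      (hnK.trans_le (Nat.pow_le_pow_left hb1 2))]
    ring
  have hrest0 : 0 ≤ ∑ b ∈ Finset.Ioc K X, ((n / b : ℕ) : ℝ) * Real.log b :=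
    Finset.sum_nonneg fun b _ => mul_nonneg (Nat.cast_nonneg _) (Real.log_natCast_nonneg b)
  have hrest : ∑ b ∈ Finset.Ioc K X, ((n / b : ℕ) : ℝ) * Real.log b ≤ n * K * Real.log n := by
    refine (Finset.sum_le_card_nsmul _ _ ((K : ℝ) * Real.log n) fun b hb => ?_).trans ?_
    · obtain ⟨hb1, hb2⟩ := Finset.mem_Ioc.1 hb
      refine mul_le_mul ?_ (Real.log_le_log (by exact_mod_cast (by omega : 0 < b))
        (by exact_mod_cast hb2.trans hXn)) (Real.log_natCast_nonneg b) (Nat.cast_nonneg K)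
      have : n / b < K + 1 := Nat.div_lt_of_lt_mul (by nlinarith)
      exact_mod_cast Nat.lt_succ_iff.1 this
    · rw [nsmul_eq_mul, Nat.card_Ioc, mul_assoc]
      refine mul_le_mul_of_nonneg_right ?_ (by positivity)
      exact_mod_cast (Nat.sub_le X K).trans hXn
  have hmain : |∑ k ∈ Finset.Ioc 0 K, ∑ b ∈ Finset.Ioc K (min X (n / k)),
        (2 * (k : ℝ) * b - n) * Real.log b -
      ∑ k ∈ Finset.Ioc 0 K, (2 * (k : ℝ) *
        (((min (α * n) (n / k)) ^ 2 / 2 * Real.log (min (α * n) (n / k)) -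
            (min (α * n) (n / k)) ^ 2 / 4) -
          ((K : ℝ) ^ 2 / 2 * Real.log K - (K : ℝ) ^ 2 / 4)) -
        n * ((min (α * n) (n / k) * Real.log (min (α * n) (n / k)) - min (α * n) (n / k)) -
          (K * Real.log K - K)))| ≤ K * (3 * n * Real.log n) := by
    rw [← Finset.sum_sub_distrib]
    refine (Finset.abs_sum_le_sum_abs _ _).trans ?_
    refine (Finset.sum_le_card_nsmul _ _ (3 * n * Real.log n) fun k hk => ?_).trans
      (by simp)
    obtain ⟨hk1, hk2⟩ := Finset.mem_Ioc.1 hk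
    have hk0 : (0 : ℝ) < k := by exact_mod_cast hk1
    -- The integer cutoff is the floor of the real one, so the integral comparison applies at the
    -- real endpoint.
    have hfloor : min X (n / k) = ⌊min (α * n) ((n : ℝ) / k)⌋₊ := by
      rw [(Nat.floor_mono (R := ℝ)).map_min, Nat.floor_div_natCast, Nat.floor_natCast]
    rw [hfloor]
    refine abs_sum_linear_mul_log_sub_le n K k hK1 hk1 _ (le_min (hKs.trans hsx) ?_)
      (min_le_right _ _)
    rw [le_div_iff₀ hk0]
    exact_mod_cast (Nat.mul_le_mul_left K hk2).trans (by rwa [← sq])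
  rw [sum_main_terms_eq n K q (by omega) α hα0 hqK
    (fun k _ => Nat.le_floor_iff (by positivity))
    (fun y => y ^ 2 / 2 * Real.log y - y ^ 2 / 4) (fun y => y * Real.log y - y)
    (fun _ => rfl) (fun _ => rfl)] at hmain
  have hbdry := abs_boundary_term_le n hn K hK1 hKn (by nlinarith)
  rw [limit_terms_eq n (by omega) α hα0, log_partialProduct,
    ← Finset.sum_Ioc_consecutive _ hK1 hKX, hlarge]
  rw [abs_le] at *
  constructor <;> linarith [hsmall.1, hsmall.2, hmain.1, hmain.2, hbdry.1, hbdry.2]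

theorem theorem1p2 :
    ∃ C : ℝ, ∀ n : ℕ, 2 ≤ n →
      (∀ α : ℝ, 1 / Real.sqrt (n : ℝ) ≤ α → α ≤ 1 →
        |Real.log (GenBinomProd.partialProduct n (α * (n : ℝ)))
            - (GenBinomProd.limitF α * (n : ℝ) ^ 2 * Real.log (n : ℝ)
              + GenBinomProd.limitG α * (n : ℝ) ^ 2)|
          ≤ C * ((n : ℝ) ^ (3 / 2 : ℝ) * Real.log (n : ℝ))) ∧
      (∀ α : ℝ, 1 / (n : ℝ) ≤ α → α ≤ 1 / Real.sqrt (n : ℝ) →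
        |Real.log (GenBinomProd.partialProduct n (α * (n : ℝ)))|
          ≤ C * ((n : ℝ) ^ (3 / 2 : ℝ) * Real.log (n : ℝ))) := by
  -- `48 = 4 + 1 + 3 + 40`: small bases, the term `-q`, integral comparison, boundary.
  refine ⟨48, fun n hn => ?_⟩
  have hn0 : (0 : ℝ) < n := by exact_mod_cast (by omega : 0 < n)
  have hlogn : 0 ≤ Real.log n := Real.log_natCast_nonneg n
  have hpow : (n : ℝ) ^ (3 / 2 : ℝ) = n * Real.sqrt n := by
    rw [show (3 / 2 : ℝ) = 1 + 1 / 2 by norm_num, Real.rpow_add hn0, Real.rpow_one,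
      Real.sqrt_eq_rpow]
  have hbound : (n : ℝ) * Nat.sqrt n * Real.log n ≤ (n : ℝ) ^ (3 / 2 : ℝ) * Real.log n := by
    rw [hpow]
    exact mul_le_mul_of_nonneg_right
      (mul_le_mul_of_nonneg_left Real.nat_sqrt_le_real_sqrt hn0.le) hlogn
  refine ⟨fun α h1 h2 => ?_, fun α _ h2 => ?_⟩
  · exact (abs_sum_radixExponent_sub_limit_le n hn α h1 h2).trans (by linarith)
  · have hx : α * n ≤ Real.sqrt n := by
      refine (mul_le_mul_of_nonneg_right h2 hn0.le).trans (le_of_eq ?_)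
      rw [one_div, inv_mul_eq_div, Real.div_sqrt]
    have hX : ⌊α * n⌋₊ ≤ Nat.sqrt n := by
      rw [← Real.nat_floor_real_sqrt_eq_nat_sqrt]
      exact Nat.floor_mono hx
    have hX' : (⌊α * n⌋₊ : ℝ) ≤ Nat.sqrt n := by exact_mod_cast hX
    rw [log_partialProduct]
    refine (abs_sum_radixExponent_mul_log_le n _ (hX.trans (Nat.sqrt_le_self n)) hn).trans ?_
    have h3 := mul_le_mul_of_nonneg_right hX' (by positivity : 0 ≤ 4 * n * Real.log n)
    have h4 : 0 ≤ (n : ℝ) * Nat.sqrt n * Real.log n := by positivity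
    linarith
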